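/- Let $\mathbf F$ be a finite field with $q$ elements, let $k$ be a field in which $q\neq 0$, let $n\ge 0$, and put $V=\mathbf F^n$. Let $k[\mathfrak M_n]$ be the monoid algebra over $k$ of the multiplicative monoid $\mathfrak M_n$ of $n\times n$ matrices over $\mathbf F$ (equivalently, of linear maps $V\to V$), with basis vectors $[m]$. Put $\mu(i)=(-1)^i q^{\binom i2}$, let $\binom{a}{b}_q$ be the $q$-binomial coefficient, and let $\operatorname{srk}(m)$ be the rank of $m^i$ for $i\gg0$. A linear map $T\colon V\to V$ is *semi-idempotent* if $V=X\oplus Y$ with $X,Y$ stable under $T$, $T|_X=\mathrm{id}$ and $T|_Y$ nilpotent. For $0\le r\le n$ and for a subspace $W\subset V$ define $$\eta_r=q^{-(n-1)r}\mu(r)\sum_{\substack{m \text{ semi-idempotent}\\ \operatorname{rank} m\le r}}\mu(\operatorname{srk} m)\binom{n-1-\operatorname{rank} m}{r-\operatorname{rank} m}_q[m],$$ $$\eta_W=q^{-\dim W\,\dim(V/W)}\mu(\dim W)^{-1}\sum_{\substack{T\text{ semi-idempotent}\\ \operatorname{im}T\subset W}}\mu(\operatorname{srk}T)\,[T],$$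 where $\binom{-1}{0}_q=1$ (this occurs only for $r=n=\operatorname{rank} m$). Let $\mathcal G_{n,r}$ be the groupoid whose objects are the $r$-dimensional subspaces of $V$ and whose morphisms are the linear isomorphisms between them, let $k[\mathcal G_{n,r}]$ be its groupoid algebra, with one basis vector $[a]$ for each morphism $a$, and let $\psi_r\colon k[\mathfrak M_n]\to k[\mathcal G_{n,r}]$ be the $k$-linear map $\psi_r([m])=\sum_U[m|_U]$, the sum over the $r$-dimensional subspaces $U$ of $V$ such that $\dim m(U)=r$, with $m|_U$ regarded as an isomorphism $U\to m(U)$. Then: 1. The $\eta_W$, for $W$ ranging over the subspaces of $V$, are pairwise orthogonal idempotents: $\eta_W^2=\eta_W$, and $\eta_{W_1}\eta_{W_2}=0$ for $W_1\ne W_2$. 2. $\eta_r=\sum_{\dim W\le r}\eta_W$ for all $0\le r\le n$. 3. For every $r \ge 0$ and every subspace $W\subset V$: $\psi_r(\eta_W)=[\mathrm{id}_W]$ if $\dim W=r$, and $\psi_r(\eta_W)=0$ if $\dim W<r$. -/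

import Mathlib

namespace UnitDecomp

open Module

noncomputable section

/-! ### `q`-binomial coefficients and the quantity `μ` -/

/-- The `q`-integer `[n]_q = 1 + q + ⋯ + q^(n-1)`. -/
def qInt (q n : ℕ) : ℕ := ∑ i ∈ Finset.range n, q ^ i

/-- The `q`-factorial `[n]_q! = [1]_q [2]_q ⋯ [n]_q`. -/
def qFactorial (q n : ℕ) : ℕ := ∏ i ∈ Finset.range n, qInt q (i + 1)

/-- The `q`-binomial coefficient `[n]_q! / ([m]_q! [n-m]_q!)`, equal to `0` for `m > n`.
The division is exact, see `qFactorial_mul_dvd` and `qBinom_mul`. -/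
def qBinom (q n m : ℕ) : ℕ :=
  if m ≤ n then qFactorial q n / (qFactorial q m * qFactorial q (n - m)) else 0

lemma qInt_add (q a b : ℕ) : qInt q (a + b) = qInt q a + q ^ a * qInt q b := by
  simp [qInt, Finset.sum_range_add, pow_add, Finset.mul_sum]

lemma qFactorial_succ (q n : ℕ) : qFactorial q (n + 1) = qFactorial q n * qInt q (n + 1) := by
  simp [qFactorial, Finset.prod_range_succ]

lemma qFactorial_mul_dvd (q a b : ℕ) :
    qFactorial q a * qFactorial q b ∣ qFactorial q (a + b) := by
  induction a generalizing b with
  | zero => simp [qFactorial]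
  | succ a iha =>
    induction b with
    | zero => simp [qFactorial]
    | succ b ihb =>
      have e : a + 1 + (b + 1) = a + 1 + b + 1 := rfl
      rw [e, qFactorial_succ q (a + 1 + b), ← e, qInt_add, mul_add]
      refine dvd_add ?_ ?_
      · have h := mul_dvd_mul_right (iha (b + 1)) (qInt q (a + 1))
        have e' : a + (b + 1) = a + 1 + b := by omega
        rw [e'] at h
        rw [qFactorial_succ q a]
        convert h using 1
        ring
      · have h := mul_dvd_mul_right ihb (qInt q (b + 1))
        rw [qFactorial_succ q b]
        have h2 := Dvd.dvd.mul_left h (q ^ (a + 1))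
        convert h2 using 1 <;> ring

lemma qBinom_mul (q : ℕ) {n m : ℕ} (h : m ≤ n) :
    qBinom q n m * (qFactorial q m * qFactorial q (n - m)) = qFactorial q n := by
  rw [qBinom, if_pos h]
  refine Nat.div_mul_cancel ?_
  have := qFactorial_mul_dvd q m (n - m)
  rwa [Nat.add_sub_cancel' h] at this

section

variable (k : Type*) [Field k] (F : Type*) [Field F] [Fintype F] {n : ℕ}

/-- The cardinality `q` of the finite field `F`, as an element of `k`. -/
def qElt : k := (Fintype.card F : k)

/-- `μ(i) = (-1)^i q^(i choose 2)`, as an element of `k`. -/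
def mu (i : ℕ) : k := (-1) ^ i * qElt k F ^ i.choose 2

end

/-! ### Semi-idempotent matrices and the stable rank -/

/-- An operator `T` on `V` is semi-idempotent if `V = X ⊕ Y` with `X`, `Y` stable under `T`, `T`
the identity on `X`, and `T` nilpotent on `Y`. -/
def IsSemiIdempotent {F V : Type*} [Field F] [AddCommGroup V] [Module F V] (T : V →ₗ[F] V) :
    Prop :=
  ∃ X Y : Submodule F V, IsCompl X Y ∧ (∀ x ∈ X, T x = x) ∧
    ∃ hY : ∀ y ∈ Y, T y ∈ Y, IsNilpotent (T.restrict hY)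

/-- The stable rank of an `n × n` matrix: the rank of `m ^ i` for all large `i`. Powers `i ≥ n` are
large enough, see `rank_pow_eq_stableRank`. -/
def stableRank {F : Type*} [Field F] {n : ℕ} (m : Matrix (Fin n) (Fin n) F) : ℕ := (m ^ n).rank

lemma rank_pow_eq_stableRank {F : Type*} [Field F] {n : ℕ} (m : Matrix (Fin n) (Fin n) F)
    {i : ℕ} (hi : n ≤ i) : (m ^ i).rank = stableRank m := by
  have key (j : ℕ) : (m ^ j).rank + finrank F (LinearMap.ker (Matrix.toLin' m ^ j)) = n := by
    have h := LinearMap.finrank_range_add_finrank_ker (Matrix.toLin' m ^ j)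
    rw [← Matrix.toLin'_pow] at h ⊢
    rw [finrank_fin_fun, Matrix.toLin'_apply'] at h
    exact h
  have h1 := key i
  have h2 := key n
  have h3 := Module.End.ker_pow_eq_ker_pow_finrank_of_le (f := Matrix.toLin' m) (m := i)
    (by simpa using hi)
  rw [Module.finrank_fin_fun] at h3
  rw [h3] at h1
  rw [stableRank]
  omega

/-! ### The elements `η_r` and `η_W` of the monoid algebra -/

section

variable (k : Type*) [Field k] (F : Type*) [Field F] [Fintype F] (n : ℕ)

instance instFintypeSubmodule : Fintype (Submodule F (Fin n → F)) := Fintype.ofFinite _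

/-- The monoid algebra `k[M_n]` of the multiplicative monoid of `n × n` matrices over `F`; the
basis vector of a matrix `m` is `MonoidAlgebra.single m 1`. -/
abbrev MatAlg : Type _ := MonoidAlgebra k (Matrix (Fin n) (Fin n) F)

open Classical in
/-- `η_r = q^(-(n-1)r) μ(r) ∑_m μ(srk m) [n-1-rank m choose r-rank m]_q [m]`, the sum over all
semi-idempotent matrices `m` of rank at most `r`. For `r ≤ n`, natural-number subtraction truncates
in one case only, `rank m = r = n`, where the coefficient is read as `[-1 choose 0]_q = 1`. -/
def etaRank (r : ℕ) : MatAlg k F n :=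
  (qElt k F ^ (-(((n : ℤ) - 1) * r)) * mu k F r) •
    ∑ m : Matrix (Fin n) (Fin n) F with IsSemiIdempotent (Matrix.toLin' m) ∧ m.rank ≤ r,
      (mu k F (stableRank m) *
        (qBinom (Fintype.card F) (n - 1 - m.rank) (r - m.rank) : k)) • MonoidAlgebra.single m 1

variable {F n}

open Classical in
/-- `η_W = q^(-dim W dim(V/W)) μ(dim W)⁻¹ ∑_T μ(srk T) [T]`, the sum over all semi-idempotent `T`
with image contained in `W`, where `V = F^n`. -/
def etaSub (W : Submodule F (Fin n → F)) : MatAlg k F n :=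
  (qElt k F ^ (-((finrank F W : ℤ) * finrank F ((Fin n → F) ⧸ W))) *
      (mu k F (finrank F W))⁻¹) •
    ∑ m : Matrix (Fin n) (Fin n) F with
        IsSemiIdempotent (Matrix.toLin' m) ∧ LinearMap.range (Matrix.toLin' m) ≤ W,
      mu k F (stableRank m) • MonoidAlgebra.single m 1

end

/-! ### The groupoid `G_{n,r}` and the map `ψ_r` -/

section

variable (k : Type*) [Field k] (F : Type*) [Field F] (n r : ℕ)

/-- Objects of the groupoid `G_{n,r}`: the `r`-dimensional subspaces of `F^n`. -/
abbrev GObj : Type _ := {U : Submodule F (Fin n → F) // finrank F U = r}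

/-- Morphisms of the groupoid `G_{n,r}`, with source and target: linear isomorphisms `U ≃ U'` of
`r`-dimensional subspaces of `F^n`. -/
abbrev GMor : Type _ := Σ U : GObj F n r, Σ U' : GObj F n r, U.1 ≃ₗ[F] U'.1

/-- The groupoid algebra `k[G_{n,r}] = ⨁_{U, U'} k[Isom(U, U')]` as a `k`-vector space; the
basis vector of a morphism `a` is `Finsupp.single a 1`. -/
abbrev GAlg : Type _ := GMor F n r →₀ k

variable {F n}

/-- A linear map `T` whose image of the subspace `U` has the dimension of `U` restricts to an
isomorphism from `U` to `T(U)`. -/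
def restrictIso (T : (Fin n → F) →ₗ[F] (Fin n → F)) (U : Submodule F (Fin n → F))
    (h : finrank F (U.map T) = finrank F U) : U ≃ₗ[F] U.map T :=
  LinearEquiv.ofBijective (T.submoduleMap U)
    ⟨(LinearMap.injective_iff_surjective_of_finrank_eq_finrank h.symm).2
      (T.submoduleMap_surjective U), T.submoduleMap_surjective U⟩

@[simp] lemma coe_restrictIso (T : (Fin n → F) →ₗ[F] (Fin n → F)) (U : Submodule F (Fin n → F))
    (h : finrank F (U.map T) = finrank F U) (u : U) :
    (restrictIso T U h u : Fin n → F) = T u := rfl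

variable [Fintype F]

open Classical in
/-- The linear map `ψ_r : k[M_n] → k[G_{n,r}]` with `ψ_r [m] = ∑_U [m|_U]`, the sum over the
`r`-dimensional subspaces `U` of `F^n` such that `m(U)` also has dimension `r`, where `m|_U` is
regarded as an isomorphism from `U` to `m(U)`. -/
def psi : MatAlg k F n →ₗ[k] GAlg k F n r :=
  Finsupp.linearCombination k (fun m : Matrix (Fin n) (Fin n) F =>
    ∑ U : GObj F n r,
      if h : finrank F (U.1.map (Matrix.toLin' m)) = r then
        (Finsupp.single
          (⟨U, ⟨U.1.map (Matrix.toLin' m), h⟩,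
            restrictIso (Matrix.toLin' m) U.1 (h.trans U.2.symm)⟩ : GMor F n r) 1 : GAlg k F n r)
      else 0) ∘ₗ (MonoidAlgebra.coeffLinearEquiv k).toLinearMap

/-- The basis vector `[id_W]` of `k[G_{n,r}]` for an `r`-dimensional subspace `W` of `F^n`. -/
def idVec (W : GObj F n r) : GAlg k F n r :=
  Finsupp.single ⟨W, W, LinearEquiv.refl F W.1⟩ 1

open Classical in
lemma psi_single (m : Matrix (Fin n) (Fin n) F) :
    psi k r (MonoidAlgebra.single m (1 : k)) =
      ∑ U : GObj F n r,
        if h : finrank F (U.1.map (Matrix.toLin' m)) = r then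
          (Finsupp.single
            (⟨U, ⟨U.1.map (Matrix.toLin' m), h⟩,
              restrictIso (Matrix.toLin' m) U.1 (h.trans U.2.symm)⟩ : GMor F n r) 1 :
                GAlg k F n r)
        else 0 := by
  simp [psi]

end

end

end UnitDecomp

namespace UnitDecomp

open Module

noncomputable section

/-! Everything rests on one cancellation. Write `φ ⊗ v` for the operator `x ↦ φ(x) v`. If `φ ≠ 0`,
the weights `μ(srk)` of the semi-idempotent operators among the `T + φ ⊗ v`, with `v` running over
the whole space, sum to zero; by transposition the same holds for a fixed `v ≠ 0` and varying `φ`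
(`sum_semiWeight_add_smulRight` and its dual form). The weight is trace-like: it agrees on `AB` and
`BA`. So an induction on dimension can pass to a quotient by a common kernel vector, or to the image
of `T`. The terms left over are identity operators, and they cancel because `μ(d) = -q^(d-1)
μ(d-1)`.

Let `e_W` be the sum in `η_W`. As `q` is invertible in `k`, a function of `T` that is unchanged by
`φ ⊗ v` for all `v ∈ W`, with `φ` nonzero on `W`, has weighted sum zero; so has one unchanged by `φ
⊗ w` for all `φ`, with `w ∈ W` nonzero. Hence `e_W [S] = 0` unless `W ⊆ im S`, and `[S] e_W = 0`
unless `S` is injective on `W`. This yields orthogonality, and it also kills the components of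
`ψ_r(e_W)` with source `U ≠ W` when `dim W = r`. The surviving `T` are injective on `W` with image
in `W`, and such a `T` has nonzero weight only if it is a projection onto `W`. There are `q^(dim W
dim(V/W))` projections, which explains the normalisation of `η_W`.

For `η_r`, coefficients of `[m]` are compared: the sum over the subspaces of dimension at most `r`
containing `im m` telescopes by the `q`-Pascal identity. -/

open Classical in
/-- The coefficient of `T` in the unnormalised `η_W`: `μ(dim ker (T - 1))` if `T` is
semi-idempotent, expressed as `T ^ (N + 1) = T ^ N` for some `N`, and `0` otherwise. -/
def semiWeight (k : Type*) [Field k] {F W : Type*} [Field F] [Fintype F] [AddCommGroup W]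
    [Module F W] (T : End F W) : k :=
  if ∃ N, T ^ (N + 1) = T ^ N then mu k F (finrank F (LinearMap.ker (T - 1))) else 0

lemma mu_succ (k : Type*) [Field k] (F : Type*) [Fintype F] (i : ℕ) :
    mu k F (i + 1) = - (qElt k F ^ i * mu k F i) := by
  simp only [mu, Nat.choose_succ_left i 2 (by norm_num)]
  simp [pow_succ, pow_add]; ring

/-! ### The weight under exchange of factors and transposition -/

section

variable {F : Type*} [Field F]

lemma comp_mul_pow {X Y : Type*} [AddCommGroup X] [Module F X] [AddCommGroup Y] [Module F Y]
    (A : Y →ₗ[F] X) (B : X →ₗ[F] Y) (N : ℕ) :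
    (B ∘ₗ A : End F Y) ^ (N + 1) = B ∘ₗ ((A ∘ₗ B : End F X) ^ N) ∘ₗ A := by
  induction N with
  | zero => ext; simp
  | succ N ih => rw [pow_succ, ih, pow_succ]; ext; simp

lemma stabilizes_comp_of_stabilizes_comp {X Y : Type*} [AddCommGroup X] [Module F X]
    [AddCommGroup Y] [Module F Y] {A : Y →ₗ[F] X} {B : X →ₗ[F] Y}
    (h : ∃ N, (A ∘ₗ B : End F X) ^ (N + 1) = (A ∘ₗ B) ^ N) :
    ∃ N, (B ∘ₗ A : End F Y) ^ (N + 1) = (B ∘ₗ A) ^ N := by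
  obtain ⟨N, hN⟩ := h
  -- One more power is needed, since `(BA)^(N+1) = B (AB)^N A`.
  exact ⟨N + 1, by rw [comp_mul_pow A B (N + 1), comp_mul_pow A B N, hN]⟩

/-- The fixed spaces of `A ∘ B` and `B ∘ A` are isomorphic. -/
def fixedEquiv {X Y : Type*} [AddCommGroup X] [Module F X] [AddCommGroup Y] [Module F Y]
    (A : Y →ₗ[F] X) (B : X →ₗ[F] Y) :
    LinearMap.ker (A ∘ₗ B - 1 : End F X) ≃ₗ[F] LinearMap.ker (B ∘ₗ A - 1 : End F Y) :=
  LinearEquiv.ofLinearMap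
    (B.restrict fun x hx => by
      have : A (B x) = x := by simpa [sub_eq_zero] using hx
      simp [this])
    (A.restrict fun x hx => by
      have : B (A x) = x := by simpa [sub_eq_zero] using hx
      simp [this])
    (by ext ⟨x, hx⟩; simpa [sub_eq_zero] using hx)
    (by ext ⟨x, hx⟩; simpa [sub_eq_zero] using hx)

variable [Fintype F] (k : Type*) [Field k]

/-- Stabilisation of powers passes between `AB` and `BA`, and `A`, `B` are mutually inverse on the
fixed spaces. This moves an operator to any space through which it factors. -/
lemma semiWeight_comp_comm {X Y : Type*} [AddCommGroup X] [Module F X] [AddCommGroup Y]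
    [Module F Y] (A : Y →ₗ[F] X) (B : X →ₗ[F] Y) :
    semiWeight k (A ∘ₗ B) = semiWeight k (B ∘ₗ A) := by
  rw [semiWeight, semiWeight, (fixedEquiv A B).finrank_eq]
  classical
  exact if_congr ⟨stabilizes_comp_of_stabilizes_comp, stabilizes_comp_of_stabilizes_comp⟩ rfl rfl

-- An injective `T ^ N` can be cancelled from `T ^ N * T = T ^ N`.
open Classical in
lemma semiWeight_of_injective {W : Type*} [AddCommGroup W] [Module F W] {T : End F W}
    (hT : Function.Injective T) :
    semiWeight k T = if T = 1 then mu k F (finrank F W) else 0 := by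
  have h : (∃ N, T ^ (N + 1) = T ^ N) ↔ T = 1 := by
    refine ⟨fun ⟨N, hN⟩ => LinearMap.ext fun x => ?_, fun h => ⟨0, by simp [h]⟩⟩
    have h2 : Function.Injective (T ^ N) := by
      rw [Module.End.coe_pow]; exact hT.iterate N
    apply h2
    have := LinearMap.congr_fun hN x
    rwa [pow_succ] at this
  rw [semiWeight, if_congr h rfl rfl]
  by_cases h1 : T = 1
  · subst h1
    rw [if_pos rfl, if_pos rfl, sub_self, LinearMap.ker_zero, finrank_top]
  · simp [h1]

lemma semiWeight_dualMap {W : Type*} [AddCommGroup W] [Module F W] [FiniteDimensional F W]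
    (T : End F W) : semiWeight k (W := Dual F W) (LinearMap.dualMap T) = semiWeight k T := by
  have hp (N : ℕ) : (LinearMap.dualMap T : End F (Dual F W)) ^ N = LinearMap.dualMap (T ^ N) := by
    induction N with
    | zero => ext; simp
    | succ N ih => rw [pow_succ', ih, pow_succ]; ext; simp
  have hinj : Function.Injective (LinearMap.dualMap : End F W → End F (Dual F W)) := by
    intro A B h
    ext x
    rw [← sub_eq_zero, ← Module.forall_dual_apply_eq_zero_iff F]
    intro φ
    simpa [sub_eq_zero] using LinearMap.congr_fun (LinearMap.congr_fun h φ) x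
  have h1 : (LinearMap.dualMap T : End F (Dual F W)) - 1 = LinearMap.dualMap (T - 1) := by
    ext; simp
  rw [semiWeight, semiWeight]
  have h2 : finrank F (LinearMap.ker ((LinearMap.dualMap T : End F (Dual F W)) - 1)) =
      finrank F (LinearMap.ker (T - 1)) := by
    have e1 := LinearMap.finrank_range_add_finrank_ker (LinearMap.dualMap (T - 1))
    have e2 := LinearMap.finrank_range_add_finrank_ker (T - 1)
    rw [LinearMap.finrank_range_dualMap_eq_finrank_range, Subspace.dual_finrank_eq] at e1
    rw [h1]
    omega
  rw [h2]
  classical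
  refine if_congr (exists_congr fun N => ?_) rfl rfl
  rw [hp, hp, hinj.eq_iff]

end

lemma sum_comp_surjective_eq_zero {A B M : Type*} [AddCommGroup A] [AddCommGroup B] [Fintype A]
    [Fintype B] [AddCommMonoid M] (π : A →+ B) (hπ : Function.Surjective π) (g : B → M)
    (hg : ∑ b, g b = 0) : ∑ a, g (π a) = 0 := by
  classical
  rw [Finset.sum_comp g π, Finset.image_univ_of_surjective hπ]
  have h (b : B) : (Finset.univ.filter fun a => π a = b).card =
      (Finset.univ.filter fun a => π a = 0).card :=
    AddMonoidHom.card_fiber_eq_of_mem_range π (hπ b) (hπ 0)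
  simp_rw [h, ← Finset.smul_sum, hg, smul_zero]

/-! ### Cancellation over rank-one perturbations -/

section

universe u
variable {F : Type*} [Field F] [Fintype F] (k : Type*) [Field k]

/-- The vanishing of the sum of `semiWeight` over a family `T + φ ⊗ v`, by restriction to the range
of `T`, when `T` is injective on `ker φ` and kills a complement. -/
lemma sum_semiWeight_of_injOn {W : Type u} [AddCommGroup W] [Module F W]
    [Fintype W] [FiniteDimensional F W] (φ : Dual F W) (T : End F W) {w : W} (hw : φ w = 1)
    (hTw : T w = 0) (hT : ∀ x, φ x = 0 → T x = 0 → x = 0)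
    (ih : ∀ (H : Submodule F W) [Fintype H] (ψ : Dual F H) (S : End F H),
      finrank F H < finrank F W → ψ ≠ 0 → ∑ v : H, semiWeight k (S + ψ.smulRight v) = 0) :
    ∑ v : W, semiWeight k (T + φ.smulRight v) = 0 := by
  classical
  have hw0 : w ≠ 0 := by rintro rfl; simp at hw
  set H := LinearMap.range T
  have hker : LinearMap.ker T = F ∙ w := by
    ext x
    rw [LinearMap.mem_ker, Submodule.mem_span_singleton]
    refine ⟨fun hx => ⟨φ x, ?_⟩, ?_⟩
    · exact (sub_eq_zero.1 (hT (x - φ x • w) (by simp [hw]) (by simp [hx, hTw]))).symm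
    · rintro ⟨a, rfl⟩
      simp [hTw]
  have hrank : finrank F H + 1 = finrank F W := by
    rw [← LinearMap.finrank_range_add_finrank_ker T, hker, finrank_span_singleton hw0]
  have hrange (y : W) : ∃ x, φ x = 0 ∧ T x = T y :=
    ⟨y - φ y • w, by simp [hw], by simp [hTw]⟩
  have hinj (v : W) (hv : v ∉ H) : Function.Injective (T + φ.smulRight v) := by
    rw [injective_iff_map_eq_zero]
    intro x hx
    replace hx : T x + φ x • v = 0 := by simpa using hx
    by_cases h : φ x = 0
    · exact hT x h (by simpa [h] using hx)
    · refine absurd ⟨-(φ x)⁻¹ • x, ?_⟩ hv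
      rw [map_smul, eq_neg_of_add_eq_zero_left hx, smul_neg, neg_smul, neg_neg, smul_smul,
        inv_mul_cancel₀ h, one_smul]
  -- For `v ∈ H` the perturbed operator has image in `H`, so its weight is that of its restriction
  -- to `H`.
  have hfac (v : H) : semiWeight k (T + φ.smulRight (v : W)) =
      semiWeight k (T.rangeRestrict ∘ₗ H.subtype + (φ ∘ₗ H.subtype).smulRight v) := by
    have e : T + φ.smulRight (v : W) = H.subtype ∘ₗ (T.rangeRestrict + φ.smulRight v) := by
      ext x; simp
    rw [e, semiWeight_comp_comm]
    congr 1
  have hsplit : ∑ v : W, semiWeight k (T + φ.smulRight v) =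
      (∑ v : H, semiWeight k (T + φ.smulRight (v : W))) +
        ∑ v ∈ Finset.univ.filter (fun v => v ∉ H), semiWeight k (T + φ.smulRight v) := by
    rw [← Finset.sum_filter_add_sum_filter_not Finset.univ (fun v => v ∈ H)]
    congr 1
    exact (Finset.sum_subtype (p := (· ∈ H)) _ (fun v => Finset.mem_filter_univ v) _)
  rw [hsplit]
  -- If `φ` vanishes on `H`, then `H = ker φ` and all `v ∈ H` contribute the same weight, to be
  -- offset by one identity operator outside `H`. Otherwise the part over `H` vanishes by induction.
  by_cases hφ : φ ∘ₗ H.subtype = 0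
  · have hφ' (x : W) (hx : x ∈ H) : φ x = 0 := LinearMap.congr_fun hφ ⟨x, hx⟩
    have hHφ : H = LinearMap.ker φ := by
      refine Submodule.eq_of_le_of_finrank_le (fun x hx => hφ' x hx) ?_
      have h1 : finrank F (LinearMap.ker φ) < finrank F W := by
        apply Submodule.finrank_lt
        intro h
        have : w ∈ LinearMap.ker φ := h ▸ Submodule.mem_top
        simp [hw] at this
      omega
    have hR : Function.Injective (T.rangeRestrict ∘ₗ H.subtype : End F H) := by
      rw [injective_iff_map_eq_zero]
      rintro ⟨x, hx⟩ h
      exact Subtype.ext (hT x (hφ' x hx) (congrArg Subtype.val h))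
    have hone : (T + φ.smulRight w = 1) ↔ (T.rangeRestrict ∘ₗ H.subtype : End F H) = 1 := by
      constructor
      · intro h
        ext ⟨x, hx⟩
        simpa [hφ' x hx] using LinearMap.congr_fun h x
      · intro h
        ext x
        have hx : x - φ x • w ∈ H := by rw [hHφ]; simp [hw]
        have := congrArg Subtype.val (LinearMap.congr_fun h ⟨_, hx⟩)
        simp [hTw] at this
        simp [this]
    simp_rw [hfac, hφ]
    -- The perturbed operator sends `w` to `v`, so it can be the identity only for `v = w`.
    have hs2 : ∑ v ∈ Finset.univ.filter (fun v => v ∉ H), semiWeight k (T + φ.smulRight v) =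
        semiWeight k (T + φ.smulRight w) := by
      refine Finset.sum_eq_single w (fun v hv hvw => ?_) (fun h => absurd ?_ h)
      · rw [semiWeight_of_injective k (hinj v (by simpa using hv)), if_neg]
        intro h
        apply hvw
        simpa [hTw, hw] using LinearMap.congr_fun h w
      · simp only [Finset.mem_filter_univ]
        intro h
        simpa [hw] using hφ' w h
    have hwH : w ∉ H := fun h => by simpa [hw] using hφ' w h
    have hz (v : H) : (0 : Dual F H).smulRight v = (0 : End F H) := by ext; simp
    rw [hs2, semiWeight_of_injective k (hinj w hwH)]
    simp_rw [hz, add_zero, hone]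
    -- When `T` is the identity on `H`, this is `q^(d-1) μ(d-1) + μ(d) = 0` with `d = dim W`.
    rw [semiWeight_of_injective k hR, ← hrank, mu_succ, Finset.sum_const, Finset.card_univ,
      Module.card_eq_pow_finrank (K := F) (V := H), nsmul_eq_mul]
    split_ifs <;> simp [qElt]
  · simp_rw [hfac]
    rw [ih H _ _ (by omega) hφ, zero_add]
    refine Finset.sum_eq_zero fun v hv => ?_
    rw [semiWeight_of_injective k (hinj v (by simpa using hv)), if_neg]
    -- If the perturbed operator is the identity, `T` fixes `ker φ` pointwise; as `H = T(ker φ)`,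
    -- this puts `H` inside `ker φ`.
    intro h
    apply hφ
    ext ⟨x, y, rfl⟩
    obtain ⟨x, hx, hxy⟩ := hrange y
    have := LinearMap.congr_fun h x
    simp [hx] at this
    simp [← hxy, this, hx]

/-- The sum runs over all operators agreeing with `T` on the hyperplane `ker φ`. A nonzero vector of
`ker φ` killed by `T` can be divided out; otherwise `T` is injective on `ker φ`. -/
theorem sum_semiWeight_add_smulRight {W : Type u} [AddCommGroup W] [Module F W] [Fintype W]
    [FiniteDimensional F W] (φ : Dual F W) (hφ : φ ≠ 0) (T : End F W) :
    ∑ v : W, semiWeight k (T + φ.smulRight v) = 0 := by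
  classical
  induction hd : finrank F W using Nat.strong_induction_on generalizing W with
  | _ d ih =>
  subst hd
  by_cases hl : ∃ l, l ≠ 0 ∧ φ l = 0 ∧ T l = 0
  · obtain ⟨l, hl0, hφl, hTl⟩ := hl
    have h1 : (F ∙ l) ≤ LinearMap.ker T := by simpa [Submodule.span_singleton_le_iff_mem] using hTl
    have h2 : (F ∙ l) ≤ LinearMap.ker φ := by simpa [Submodule.span_singleton_le_iff_mem] using hφl
    let _ : Fintype (W ⧸ F ∙ l) := Fintype.ofFinite _
    have hφ' : (F ∙ l).liftQ φ h2 ≠ 0 := by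
      intro h
      apply hφ
      rw [← (F ∙ l).liftQ_mkQ φ h2, h, LinearMap.zero_comp]
    have hlt : finrank F (W ⧸ F ∙ l) < finrank F W := by
      have := Submodule.finrank_quotient_add_finrank (F ∙ l)
      rw [finrank_span_singleton hl0] at this
      omega
    have := ih _ hlt _ hφ' ((F ∙ l).mkQ ∘ₗ (F ∙ l).liftQ T h1) rfl
    have := sum_comp_surjective_eq_zero (F ∙ l).mkQ.toAddMonoidHom (F ∙ l).mkQ_surjective _ this
    rw [← this]
    refine Finset.sum_congr rfl fun v _ => ?_
    have e : T + φ.smulRight v =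
        ((F ∙ l).liftQ T h1 + ((F ∙ l).liftQ φ h2).smulRight v) ∘ₗ (F ∙ l).mkQ := by
      ext x; simp
    rw [e, semiWeight_comp_comm]
    congr 1
  · push Not at hl
    obtain ⟨u, hu⟩ : ∃ u, φ u ≠ 0 := by
      by_contra! h
      exact hφ (LinearMap.ext h)
    obtain ⟨w, hw⟩ : ∃ w, φ w = 1 := ⟨(φ u)⁻¹ • u, by simp [hu]⟩
    -- Subtracting `φ ⊗ T w` makes the operator kill `w` and only shifts the summation variable.
    have := sum_semiWeight_of_injOn k φ (T + φ.smulRight (-T w)) hw (by simp [hw])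
      (fun x h1 h2 => by_contra fun h3 => hl x h3 h1 (by simpa [h1] using h2))
      (fun H _ ψ S hlt hψ => ih _ hlt ψ hψ S rfl)
    rw [← this]
    refine Fintype.sum_equiv (Equiv.addRight (T w)) _ _ fun v => ?_
    congr 1
    ext x
    simp
    abel

/-- The transpose of `φ ⊗ v` is the rank-one operator with functional evaluation at `v` and vector
`φ`. -/
theorem sum_dual_semiWeight_add_smulRight {W : Type u} [AddCommGroup W] [Module F W]
    [Fintype (Dual F W)] [FiniteDimensional F W] (v : W) (hv : v ≠ 0) (T : End F W) :
    ∑ φ : Dual F W, semiWeight k (T + φ.smulRight v) = 0 := by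
  have hev : Dual.eval F W v ≠ 0 := by
    intro h
    exact hv ((Module.eval_apply_eq_zero_iff F v).1 h)
  rw [← sum_semiWeight_add_smulRight k (W := Dual F W) (Dual.eval F W v) hev (LinearMap.dualMap T)]
  refine Finset.sum_congr rfl fun φ _ => ?_
  rw [← semiWeight_dualMap]
  congr 1
  ext ψ x
  simp [mul_comm]

end

/-! ### Weighted sums over operators with image in `W` -/

section

variable {F V : Type*} [Field F] [AddCommGroup V] [Module F V]

lemma exists_eq_subtype_comp {W : Submodule F V} {T : End F V} (h : LinearMap.range T ≤ W) :
    ∃ S : V →ₗ[F] W, T = W.subtype ∘ₗ S :=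
  ⟨T.codRestrict W fun x => h ⟨x, rfl⟩, rfl⟩

lemma range_add_smulRight_le_iff {W : Submodule F V} {T : End F V} (φ : Dual F V) {v : V}
    (hv : v ∈ W) : LinearMap.range (T + φ.smulRight v) ≤ W ↔ LinearMap.range T ≤ W := by
  simp only [LinearMap.range_le_iff_comap, Submodule.eq_top_iff', Submodule.mem_comap,
    LinearMap.add_apply, LinearMap.smulRight_apply]
  exact forall_congr' fun x => W.add_mem_iff_left (W.smul_mem _ hv)

variable [Fintype F] (k : Type*) [Field k]

open Classical in
/-- The coefficient of `T` in the unnormalised `η_W`. -/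
def imageWeight (W : Submodule F V) (T : End F V) : k :=
  if LinearMap.range T ≤ W then semiWeight k T else 0

lemma imageWeight_of_not_le {W : Submodule F V} {T : End F V} (h : ¬ LinearMap.range T ≤ W) :
    imageWeight k W T = 0 := if_neg h

lemma imageWeight_subtype_comp (W : Submodule F V) (S : V →ₗ[F] W) :
    imageWeight k W (W.subtype ∘ₗ S) = semiWeight k (S ∘ₗ W.subtype) := by
  rw [imageWeight, if_pos, semiWeight_comp_comm]
  rintro _ ⟨x, rfl⟩
  exact (S x).2

/-- An operator with image in `W` has the weight of its restriction to `W`, where the perturbation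
is by `φ|_W ⊗ v`. -/
lemma sum_imageWeight_add_smulRight [FiniteDimensional F V] (W : Submodule F V) [Fintype W]
    (φ : Dual F V) (hφ : φ ∘ₗ W.subtype ≠ 0) (T : End F V) :
    ∑ v : W, imageWeight k W (T + φ.smulRight (v : V)) = 0 := by
  by_cases h : LinearMap.range T ≤ W
  · obtain ⟨S, rfl⟩ := exists_eq_subtype_comp h
    rw [← sum_semiWeight_add_smulRight k (φ ∘ₗ W.subtype) hφ (S ∘ₗ W.subtype)]
    refine Finset.sum_congr rfl fun v _ => ?_
    have e : W.subtype ∘ₗ S + φ.smulRight (v : V) = W.subtype ∘ₗ (S + φ.smulRight v) := by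
      ext x; simp
    rw [e, imageWeight_subtype_comp]
    congr 1
  · refine Finset.sum_eq_zero fun v _ => imageWeight_of_not_le k ?_
    rwa [range_add_smulRight_le_iff φ v.2]

lemma sum_dual_imageWeight_add_smulRight [FiniteDimensional F V] [Fintype (Dual F V)]
    (W : Submodule F V) {w : V} (hw : w ≠ 0) (hwW : w ∈ W) (T : End F V) :
    ∑ φ : Dual F V, imageWeight k W (T + φ.smulRight w) = 0 := by
  by_cases h : LinearMap.range T ≤ W
  · rw [← sum_dual_semiWeight_add_smulRight k w hw T]
    exact Finset.sum_congr rfl fun φ _ => if_pos ((range_add_smulRight_le_iff φ hwW).2 h)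
  · exact Finset.sum_eq_zero fun φ _ =>
      imageWeight_of_not_le k (by rwa [range_add_smulRight_le_iff φ hwW])

/-- A weighted sum vanishes if the weights sum to zero along a finite group of translations of the
index set under which the summands are invariant. -/
lemma sum_smul_eq_zero_of_translate {A B M : Type*} [AddCommGroup A] [Fintype A] [Fintype B]
    [AddCommGroup M] [Module k M] (hB : (Fintype.card B : k) ≠ 0) (g : A → k) (G : A → M)
    (τ : B → A) (hg : ∀ a, ∑ b, g (a + τ b) = 0) (hG : ∀ a b, G (a + τ b) = G a) :
    ∑ a, g a • G a = 0 := by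
  have h : (Fintype.card B : k) • ∑ a, g a • G a = 0 := by
    calc (Fintype.card B : k) • ∑ a, g a • G a
        = ∑ b : B, ∑ a, g (a + τ b) • G (a + τ b) := by
          have (b : B) : ∑ a, g (a + τ b) • G (a + τ b) = ∑ a, g a • G a :=
            Fintype.sum_equiv (Equiv.addRight (τ b)) _ _ fun _ => rfl
          simp [this, Nat.cast_smul_eq_nsmul]
      _ = ∑ a, (∑ b, g (a + τ b)) • G a := by
          simp_rw [hG, Finset.sum_smul]
          exact Finset.sum_comm
      _ = 0 := by simp [hg]
  exact (smul_eq_zero.1 h).resolve_left hB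

variable {k}

lemma card_cast_ne_zero (hq : (Fintype.card F : k) ≠ 0) (W : Type*) [AddCommGroup W] [Module F W]
    [FiniteDimensional F W] [Fintype W] : (Fintype.card W : k) ≠ 0 := by
  rw [Module.card_eq_pow_finrank (K := F) (V := W), Nat.cast_pow]
  exact pow_ne_zero _ hq

variable {M : Type*} [AddCommGroup M] [Module k M] [Fintype (End F V)]

-- Only `T` that are injective on `W` matter, and among these the weight vanishes unless `T` is the
-- identity on `W`.
open Classical in
lemma sum_imageWeight_smul_of_injective (W : Submodule F V) (G : End F V → M)
    (hG : ∀ T, LinearMap.range T ≤ W → ∀ w ∈ W, w ≠ 0 → T w = 0 → G T = 0) :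
    ∑ T : End F V, imageWeight k W T • G T =
      mu k F (finrank F W) • ∑ T : End F V with LinearMap.IsProj W T, G T := by
  rw [Finset.smul_sum, Finset.sum_filter]
  refine Finset.sum_congr rfl fun T _ => ?_
  by_cases h : LinearMap.range T ≤ W
  · have hproj : LinearMap.IsProj W T ↔ ∀ w ∈ W, T w = w :=
      ⟨fun h => h.map_id, fun h' => ⟨fun x => h ⟨x, rfl⟩, h'⟩⟩
    by_cases h0 : ∃ w ∈ W, w ≠ 0 ∧ T w = 0
    · obtain ⟨w, hwW, hw, hTw⟩ := h0
      simp [hG T h w hwW hw hTw]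
    · push Not at h0
      obtain ⟨S, rfl⟩ := exists_eq_subtype_comp h
      have hinj : Function.Injective (S ∘ₗ W.subtype) := by
        rw [injective_iff_map_eq_zero]
        rintro ⟨w, hw⟩ hSw
        by_contra h1
        exact h0 w hw (fun h2 => h1 (Subtype.ext h2)) (congrArg Subtype.val hSw)
      have hone : S ∘ₗ W.subtype = (1 : End F W) ↔ LinearMap.IsProj W (W.subtype ∘ₗ S) := by
        rw [hproj]
        refine ⟨fun h w hw => congrArg Subtype.val (LinearMap.congr_fun h ⟨w, hw⟩), fun h => ?_⟩
        ext ⟨w, hw⟩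
        exact h w hw
      rw [imageWeight_subtype_comp, semiWeight_of_injective k hinj]
      simp only [hone, ite_smul, zero_smul]
  · rw [imageWeight_of_not_le k h, if_neg fun h' => h ?_, zero_smul]
    rintro _ ⟨x, rfl⟩
    exact h'.map_mem x

variable [FiniteDimensional F V]

lemma sum_imageWeight_smul_eq_zero (hq : (Fintype.card F : k) ≠ 0) (W : Submodule F V)
    (φ : Dual F V) (hφ : φ ∘ₗ W.subtype ≠ 0) (G : End F V → M)
    (hG : ∀ T, ∀ v ∈ W, G (T + φ.smulRight v) = G T) :
    ∑ T : End F V, imageWeight k W T • G T = 0 := by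
  have : Finite W := Module.finite_of_finite F
  let _ : Fintype W := Fintype.ofFinite W
  exact sum_smul_eq_zero_of_translate k (card_cast_ne_zero hq W) _ G
    (fun v : W => φ.smulRight (v : V)) (sum_imageWeight_add_smulRight k W φ hφ)
    fun T v => hG T v v.2

lemma sum_imageWeight_smul_eq_zero_of_dual (hq : (Fintype.card F : k) ≠ 0) (W : Submodule F V)
    {w : V} (hw : w ≠ 0) (hwW : w ∈ W) (G : End F V → M)
    (hG : ∀ T, ∀ φ : Dual F V, G (T + φ.smulRight w) = G T) :
    ∑ T : End F V, imageWeight k W T • G T = 0 := by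
  have : Finite (Dual F V) := Module.finite_of_finite F
  let _ : Fintype (Dual F V) := Fintype.ofFinite _
  exact sum_smul_eq_zero_of_translate k (card_cast_ne_zero hq (Dual F V)) _ G
    (fun φ : Dual F V => φ.smulRight w) (sum_dual_imageWeight_add_smulRight k W hw hwW) hG

-- The projections onto `W` form a torsor under `Hom(V/W, W)`, with base point `P`.
open Classical in
lemma card_isProj (W : Submodule F V) :
    (Finset.univ.filter fun T : End F V => LinearMap.IsProj W T).card =
      Fintype.card F ^ (finrank F W * finrank F (V ⧸ W)) := by
  obtain ⟨P, hP⟩ := W.subtype.exists_leftInverse_of_injective W.ker_subtype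
  have hP' (w : V) (hw : w ∈ W) : (P w : V) = w :=
    congrArg Subtype.val (LinearMap.congr_fun hP ⟨w, hw⟩)
  have : Finite (V ⧸ W →ₗ[F] W) := Module.finite_of_finite F
  let _ : Fintype (V ⧸ W →ₗ[F] W) := Fintype.ofFinite _
  have himage : (Finset.univ.filter fun T : End F V => LinearMap.IsProj W T) =
      Finset.univ.image fun D : V ⧸ W →ₗ[F] W => W.subtype ∘ₗ (P + D ∘ₗ W.mkQ) := by
    ext T
    simp only [Finset.mem_filter_univ, Finset.mem_image, Finset.mem_univ, true_and]
    constructor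
    · intro hT
      refine ⟨W.liftQ (hT.codRestrict - P) fun w hw => ?_, ?_⟩
      · refine Subtype.ext ?_
        simp [hP' w hw, hT.map_id w hw]
      · ext x
        change ((P x + (hT.codRestrict x - P x) : W) : V) = T x
        simp
    · rintro ⟨D, rfl⟩
      refine ⟨fun x => (P x + D (W.mkQ x)).2, fun w hw => ?_⟩
      simp [hP' w hw, (Submodule.Quotient.mk_eq_zero W).2 hw]
  have hinj : Function.Injective fun D : V ⧸ W →ₗ[F] W => W.subtype ∘ₗ (P + D ∘ₗ W.mkQ) := by
    intro D D' h
    ext x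
    simpa using LinearMap.congr_fun h x
  rw [himage, Finset.card_image_of_injective _ hinj, Finset.card_univ,
    Module.card_eq_pow_finrank (K := F), Module.finrank_linearMap, mul_comm]

end

/-! ### Semi-idempotence as stabilisation of powers; the normalising factor -/

section

variable {F V : Type*} [Field F] [AddCommGroup V] [Module F V]

lemma pow_add_eq_of_stabilizes {T : End F V} {N : ℕ} (h : T ^ (N + 1) = T ^ N) (j : ℕ) :
    T ^ (N + j) = T ^ N := by
  induction j with
  | zero => rfl
  | succ j ih => rw [← add_assoc, pow_succ, ih, ← pow_succ, h]

lemma pow_apply_of_fixed {T : End F V} {x : V} (h : T x = x) (i : ℕ) : (T ^ i) x = x := by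
  induction i with
  | zero => rfl
  | succ i ih => rw [pow_succ, Module.End.mul_apply, h, ih]

/-- When `T ^ (N + 1) = T ^ N`, the splitting `x = T^N x + (x - T^N x)` gives the Fitting
decomposition `ker (T - 1) ⊕ ker (T ^ N)`. -/
lemma isSemiIdempotent_iff (T : End F V) :
    IsSemiIdempotent T ↔ ∃ N, T ^ (N + 1) = T ^ N := by
  constructor
  · rintro ⟨X, Y, hXY, hX, hY, N, hN⟩
    have hNY (y : V) (hy : y ∈ Y) : (T ^ N) y = 0 := by
      have := congrArg Subtype.val (LinearMap.congr_fun hN ⟨y, hy⟩)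
      rwa [Module.End.pow_restrict] at this
    refine ⟨N, LinearMap.ext fun v => ?_⟩
    have hv : v ∈ X ⊔ Y := hXY.sup_eq_top ▸ Submodule.mem_top
    obtain ⟨x, hx, y, hy, rfl⟩ := Submodule.mem_sup.1 hv
    rw [map_add, map_add, pow_apply_of_fixed (hX x hx), pow_apply_of_fixed (hX x hx), hNY y hy,
      pow_succ', Module.End.mul_apply, hNY y hy, map_zero]
  · rintro ⟨N, hN⟩
    have hY (y : V) (hy : y ∈ LinearMap.ker (T ^ N)) : T y ∈ LinearMap.ker (T ^ N) := by
      rw [LinearMap.mem_ker] at hy ⊢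
      rw [← Module.End.mul_apply, ← pow_succ, hN, hy]
    have hX (x : V) : x ∈ LinearMap.ker (T - 1) ↔ T x = x := by simp [sub_eq_zero]
    refine ⟨LinearMap.ker (T - 1), LinearMap.ker (T ^ N), ⟨?_, ?_⟩, fun x hx => (hX x).1 hx, hY,
      N, ?_⟩
    · rw [Submodule.disjoint_def]
      intro x hx hx'
      rwa [LinearMap.mem_ker, pow_apply_of_fixed ((hX x).1 hx)] at hx'
    · rw [codisjoint_iff, Submodule.eq_top_iff']
      intro x
      refine Submodule.mem_sup.2 ⟨(T ^ N) x, ?_, x - (T ^ N) x, ?_, add_sub_cancel _ _⟩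
      · rw [hX, ← Module.End.mul_apply, ← pow_succ', hN]
      · rw [LinearMap.mem_ker, map_sub, ← Module.End.mul_apply, ← pow_add,
          pow_add_eq_of_stabilizes hN, sub_self]
    · ext ⟨x, hx⟩
      rw [Module.End.pow_restrict]
      exact hx

lemma range_pow_eq_ker_sub_one {T : End F V} {N : ℕ} (h : T ^ (N + 1) = T ^ N) :
    LinearMap.range (T ^ N) = LinearMap.ker (T - 1) := by
  ext x
  rw [LinearMap.mem_ker, LinearMap.sub_apply, Module.End.one_apply, sub_eq_zero]
  constructor
  · rintro ⟨y, rfl⟩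
    rw [← Module.End.mul_apply, ← pow_succ', h]
  · intro hx
    exact ⟨x, pow_apply_of_fixed hx N⟩

lemma stableRank_eq_finrank_ker {n : ℕ} {m : Matrix (Fin n) (Fin n) F}
    (h : ∃ N, Matrix.toLin' m ^ (N + 1) = Matrix.toLin' m ^ N) :
    stableRank m = finrank F (LinearMap.ker (Matrix.toLin' m - 1)) := by
  obtain ⟨N, hN⟩ := h
  -- The exponent is raised to at least `n`, where ranks of powers equal the stable rank.
  have h' : Matrix.toLin' m ^ (N + n + 1) = Matrix.toLin' m ^ (N + n) := by
    rw [add_assoc, pow_add_eq_of_stabilizes hN, pow_add_eq_of_stabilizes hN]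
  rw [← rank_pow_eq_stableRank m (Nat.le_add_left n N), ← range_pow_eq_ker_sub_one h',
    ← Matrix.toLin'_pow, Matrix.toLin'_apply', Matrix.rank]

/-- The normalising factor of `η_W` for `dim W = d` and `dim (V / W) = e`. -/
def etaCoeff (F : Type*) [Fintype F] (k : Type*) [Field k] (d e : ℕ) : k := qElt k F ^ (-((d : ℤ) * e)) * (mu k F d)⁻¹

lemma etaCoeff_mul {F : Type*} [Fintype F] {k : Type*} [Field k] (hq : (Fintype.card F : k) ≠ 0) (d e : ℕ) :
    etaCoeff F k d e * (mu k F d * (Fintype.card F ^ (d * e) : ℕ)) = 1 := by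
  have hq' : qElt k F ≠ 0 := hq
  have hmu : mu k F d ≠ 0 := by
    rw [mu]
    exact mul_ne_zero (pow_ne_zero _ (by simp)) (pow_ne_zero _ hq')
  have : ((Fintype.card F ^ (d * e) : ℕ) : k) = qElt k F ^ ((d : ℤ) * e) := by
    rw [← Nat.cast_mul, zpow_natCast, qElt, Nat.cast_pow]
  rw [etaCoeff, this, zpow_neg]
  field_simp

lemma single_toMatrix'_mul {F : Type*} [Field F] {n : ℕ} {k : Type*} [Field k]
    (T S : End F (Fin n → F)) :
    (MonoidAlgebra.single (LinearMap.toMatrix' (T * S)) 1 : MatAlg k F n) =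
      MonoidAlgebra.single (LinearMap.toMatrix' T) 1 *
        MonoidAlgebra.single (LinearMap.toMatrix' S) 1 := by
  rw [MonoidAlgebra.single_mul_single, LinearMap.toMatrix'_mul, one_mul]

end

/-! ### Idempotence and orthogonality -/

section

variable {F : Type*} [Field F] [Fintype F] {n : ℕ} (k : Type*) [Field k]

open Classical in
lemma semiWeight_toLin' (m : Matrix (Fin n) (Fin n) F) :
    semiWeight k (Matrix.toLin' m) =
      if IsSemiIdempotent (Matrix.toLin' m) then mu k F (stableRank m) else 0 := by
  rw [isSemiIdempotent_iff, semiWeight]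
  split_ifs with h
  · rw [stableRank_eq_finrank_ker h]
  · rfl

lemma etaSub_eq_sum_matrix (W : Submodule F (Fin n → F)) :
    etaSub k W = etaCoeff F k (finrank F W) (finrank F ((Fin n → F) ⧸ W)) •
      ∑ m : Matrix (Fin n) (Fin n) F,
        imageWeight k W (Matrix.toLin' m) • MonoidAlgebra.single m (1 : k) := by
  classical
  rw [etaSub, Finset.sum_filter]
  congr 1
  refine Finset.sum_congr (by congr!) fun m _ => ?_
  rw [imageWeight, semiWeight_toLin', ite_and]
  split_ifs <;> simp

/-- The unnormalised `η_W`. -/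
def imageSum [Fintype (End F (Fin n → F))] (W : Submodule F (Fin n → F)) : MatAlg k F n :=
  ∑ T : End F (Fin n → F),
    imageWeight k W T • MonoidAlgebra.single (LinearMap.toMatrix' T) (1 : k)

variable [Fintype (End F (Fin n → F))]

lemma etaSub_eq_smul_imageSum (W : Submodule F (Fin n → F)) :
    etaSub k W =
      etaCoeff F k (finrank F W) (finrank F ((Fin n → F) ⧸ W)) • imageSum k W := by
  rw [etaSub_eq_sum_matrix, imageSum]
  congr 1
  exact Fintype.sum_equiv Matrix.toLin'.toEquiv _ _ fun m => by simp

variable {k}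

/-- A functional vanishing on `im S` but not on `W` gives perturbations that do not change `T S`. -/
lemma imageSum_mul_single (hq : (Fintype.card F : k) ≠ 0) {W : Submodule F (Fin n → F)}
    {S : End F (Fin n → F)} (h : ¬ W ≤ LinearMap.range S) :
    imageSum k W * MonoidAlgebra.single (LinearMap.toMatrix' S) 1 = 0 := by
  obtain ⟨w, hw, hwS⟩ := SetLike.not_le_iff_exists.1 h
  obtain ⟨φ, hφw, hφS⟩ := Submodule.exists_le_ker_of_notMem hwS
  rw [imageSum, Finset.sum_mul]
  simp_rw [smul_mul_assoc, ← single_toMatrix'_mul]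
  refine sum_imageWeight_smul_eq_zero hq W φ
    (fun h0 => hφw (LinearMap.congr_fun h0 ⟨w, hw⟩)) _ fun T v _ => ?_
  congr 2
  refine LinearMap.ext fun x => ?_
  have : φ (S x) = 0 := hφS ⟨x, rfl⟩
  simp [this]

/-- Perturbing `T` by `φ ⊗ w` does not change `S T`. -/
lemma single_mul_imageSum (hq : (Fintype.card F : k) ≠ 0) {W : Submodule F (Fin n → F)}
    {S : End F (Fin n → F)} {w : Fin n → F} (hw : w ≠ 0) (hwW : w ∈ W) (hSw : S w = 0) :
    MonoidAlgebra.single (LinearMap.toMatrix' S) 1 * imageSum k W = 0 := by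
  rw [imageSum, Finset.mul_sum]
  simp_rw [mul_smul_comm, ← single_toMatrix'_mul]
  refine sum_imageWeight_smul_eq_zero_of_dual hq W hw hwW _ fun T φ => ?_
  congr 2
  refine LinearMap.ext fun x => ?_
  simp [hSw]

lemma single_mul_imageSum_of_isProj {W : Submodule F (Fin n → F)}
    {S : End F (Fin n → F)} (hS : LinearMap.IsProj W S) :
    MonoidAlgebra.single (LinearMap.toMatrix' S) 1 * imageSum k W = imageSum k W := by
  rw [imageSum, Finset.mul_sum]
  refine Finset.sum_congr rfl fun T _ => ?_
  by_cases h : LinearMap.range T ≤ W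
  · rw [mul_smul_comm, ← single_toMatrix'_mul]
    congr 3
    refine LinearMap.ext fun x => ?_
    exact hS.map_id _ (h ⟨x, rfl⟩)
  · rw [imageWeight_of_not_le k h, zero_smul, mul_zero]

lemma imageSum_mul_imageSum_self (hq : (Fintype.card F : k) ≠ 0) (W : Submodule F (Fin n → F)) :
    imageSum k W * imageSum k W =
      (mu k F (finrank F W) *
        (Fintype.card F ^ (finrank F W * finrank F ((Fin n → F) ⧸ W)) : ℕ)) • imageSum k W := by
  classical
  nth_rw 1 [imageSum]
  rw [Finset.sum_mul]
  simp_rw [smul_mul_assoc]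
  rw [sum_imageWeight_smul_of_injective W _
    fun T _ w hw h0 hTw => single_mul_imageSum hq h0 hw hTw]
  rw [Finset.sum_congr rfl fun T hT =>
    single_mul_imageSum_of_isProj ((Finset.mem_filter_univ T).1 hT), Finset.sum_const,
    card_isProj, ← Nat.cast_smul_eq_nsmul k, smul_smul]

/-- If `W₁ < W₂`, no operator with image in `W₁` is injective on `W₂`. If `W₁ ≰ W₂`, no operator
with image in `W₂` has image containing `W₁`. -/
lemma imageSum_mul_imageSum_of_ne (hq : (Fintype.card F : k) ≠ 0)
    {W₁ W₂ : Submodule F (Fin n → F)} (h : W₁ ≠ W₂) : imageSum k W₁ * imageSum k W₂ = 0 := by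
  by_cases hle : W₁ ≤ W₂
  · nth_rw 1 [imageSum]
    rw [Finset.sum_mul]
    refine Finset.sum_eq_zero fun T _ => ?_
    rw [smul_mul_assoc]
    by_cases hT : LinearMap.range T ≤ W₁
    · obtain ⟨w, hw, h0, hTw⟩ : ∃ w ∈ W₂, w ≠ 0 ∧ T w = 0 := by
        by_contra! hinj
        have h1 : Function.Injective (T.domRestrict W₂) := by
          rw [injective_iff_map_eq_zero]
          rintro ⟨x, hx⟩ hTx
          by_contra hx0
          exact hinj x hx (fun h => hx0 (Subtype.ext h)) hTx
        have h2 : LinearMap.range (T.domRestrict W₂) ≤ W₁ := by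
          rintro _ ⟨x, rfl⟩
          exact hT ⟨x, rfl⟩
        refine h (Submodule.eq_of_le_of_finrank_le hle ?_)
        rw [← LinearMap.finrank_range_of_inj h1]
        exact Submodule.finrank_mono h2
      rw [single_mul_imageSum hq h0 hw hTw, smul_zero]
    · rw [imageWeight_of_not_le k hT, zero_smul]
  · nth_rw 2 [imageSum]
    rw [Finset.mul_sum]
    refine Finset.sum_eq_zero fun S _ => ?_
    rw [mul_smul_comm]
    by_cases hS : LinearMap.range S ≤ W₂
    · by_cases hW : W₁ ≤ LinearMap.range S
      · exact absurd (hW.trans hS) hle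
      · rw [imageSum_mul_single hq hW, smul_zero]
    · rw [imageWeight_of_not_le k hS, zero_smul]

end

section

variable {F : Type*} [Field F] [Fintype F] {n : ℕ} {k : Type*} [Field k]

theorem etaSub_mul_self (hq : (Fintype.card F : k) ≠ 0) (W : Submodule F (Fin n → F)) :
    etaSub k W * etaSub k W = etaSub k W := by
  have : Finite (End F (Fin n → F)) := Module.finite_of_finite F
  let _ : Fintype (End F (Fin n → F)) := Fintype.ofFinite _
  rw [etaSub_eq_smul_imageSum, smul_mul_smul_comm, imageSum_mul_imageSum_self hq, smul_smul,
    mul_assoc, etaCoeff_mul hq, mul_one]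

theorem etaSub_mul_of_ne (hq : (Fintype.card F : k) ≠ 0) {W₁ W₂ : Submodule F (Fin n → F)}
    (h : W₁ ≠ W₂) : etaSub k W₁ * etaSub k W₂ = 0 := by
  have : Finite (End F (Fin n → F)) := Module.finite_of_finite F
  let _ : Fintype (End F (Fin n → F)) := Fintype.ofFinite _
  rw [etaSub_eq_smul_imageSum, etaSub_eq_smul_imageSum, smul_mul_smul_comm,
    imageSum_mul_imageSum_of_ne hq h, smul_zero]

end

/-! ### Values of `ψ_r` -/

section

variable (k : Type*) [Field k] {F : Type*} [Field F] {n r : ℕ}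

/-- The target is the image of the underlying map, so the values alone determine the morphism. -/
lemma single_GMor_congr {U U₁ U₂ : GObj F n r} (e₁ : U.1 ≃ₗ[F] U₁.1) (e₂ : U.1 ≃ₗ[F] U₂.1)
    (h : ∀ u, (e₁ u : Fin n → F) = e₂ u) :
    (Finsupp.single (⟨U, U₁, e₁⟩ : GMor F n r) 1 : GAlg k F n r) =
      Finsupp.single ⟨U, U₂, e₂⟩ 1 := by
  obtain rfl : U₁ = U₂ := by
    refine Subtype.ext (Submodule.ext fun x => ⟨fun hx => ?_, fun hx => ?_⟩)
    · have := h (e₁.symm ⟨x, hx⟩)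
      rw [e₁.apply_symm_apply] at this
      change x = _ at this
      rw [this]
      exact Subtype.prop _
    · have := h (e₂.symm ⟨x, hx⟩)
      rw [e₂.apply_symm_apply] at this
      change _ = x at this
      rw [← this]
      exact Subtype.prop _
  congr
  exact LinearEquiv.ext fun u => Subtype.ext (h u)

open Classical in
/-- The summand of `ψ_r([T])` at an `r`-dimensional subspace `U`. -/
def psiTerm (T : End F (Fin n → F)) (U : GObj F n r) : GAlg k F n r :=
  if h : finrank F (U.1.map T) = r then
    Finsupp.single ⟨U, ⟨U.1.map T, h⟩, restrictIso T U.1 (h.trans U.2.symm)⟩ 1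
  else 0

variable {k}

lemma psiTerm_congr {S T : End F (Fin n → F)} {U : GObj F n r} (h : ∀ u ∈ U.1, S u = T u) :
    psiTerm k S U = psiTerm k T U := by
  have hmap : U.1.map S = U.1.map T := by
    ext x
    simp only [Submodule.mem_map]
    exact exists_congr fun u => and_congr_right fun hu => by rw [h u hu]
  rw [psiTerm, psiTerm]
  split_ifs with h1 h2 h2
  · exact single_GMor_congr k _ _ fun u => h u u.2
  · exact absurd (hmap ▸ h1) h2
  · exact absurd (hmap ▸ h2) h1
  · rfl

lemma psiTerm_of_finrank_ne {T : End F (Fin n → F)} {U : GObj F n r}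
    (h : finrank F (U.1.map T) ≠ r) : psiTerm k T U = 0 := dif_neg h

lemma psiTerm_of_fixed {T : End F (Fin n → F)} {U : GObj F n r} (h : ∀ u ∈ U.1, T u = u) :
    psiTerm k T U = idVec k r U := by
  have hmap : U.1.map T = U.1 := by
    ext x
    refine ⟨?_, fun hx => ⟨x, hx, h x hx⟩⟩
    rintro ⟨u, hu, rfl⟩
    exact (h u hu).symm ▸ hu
  rw [psiTerm, dif_pos (by rw [hmap, U.2]), idVec]
  exact single_GMor_congr k _ _ fun u => h u u.2

lemma finrank_map_lt {T : End F (Fin n → F)} {W : Submodule F (Fin n → F)} {w : Fin n → F}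
    (hw : w ∈ W) (h0 : w ≠ 0) (hT : T w = 0) : finrank F (W.map T) < finrank F W := by
  have h1 := LinearMap.finrank_range_add_finrank_ker (T.domRestrict W)
  rw [LinearMap.range_domRestrict] at h1
  have h2 : 0 < finrank F (LinearMap.ker (T.domRestrict W)) := by
    refine Nat.pos_of_ne_zero fun h => ?_
    have hmem : (⟨w, hw⟩ : W) ∈ LinearMap.ker (T.domRestrict W) := hT
    rw [Submodule.finrank_eq_zero.1 h, Submodule.mem_bot] at hmem
    exact h0 (congrArg Subtype.val hmem)
  omega

variable [Fintype F]

lemma psi_imageSum [Fintype (End F (Fin n → F))] (W : Submodule F (Fin n → F)) :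
    psi k r (imageSum k W) =
      ∑ U : GObj F n r, ∑ T : End F (Fin n → F), imageWeight k W T • psiTerm k T U := by
  rw [imageSum, map_sum, Finset.sum_comm]
  refine Finset.sum_congr rfl fun T _ => ?_
  rw [map_smul, psi_single, Finset.smul_sum]
  refine Finset.sum_congr (by congr!) fun U _ => ?_
  rw [Matrix.toLin'_toMatrix', psiTerm]

theorem psi_etaSub_of_finrank_lt (W : Submodule F (Fin n → F)) (hW : finrank F W < r) :
    psi k r (etaSub k W) = 0 := by
  have : Finite (End F (Fin n → F)) := Module.finite_of_finite F
  let _ : Fintype (End F (Fin n → F)) := Fintype.ofFinite _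
  rw [etaSub_eq_smul_imageSum, map_smul, psi_imageSum]
  refine smul_eq_zero_of_right _ (Finset.sum_eq_zero fun U _ => Finset.sum_eq_zero fun T _ => ?_)
  by_cases h : LinearMap.range T ≤ W
  · rw [psiTerm_of_finrank_ne, smul_zero]
    have := Submodule.finrank_mono ((LinearMap.map_le_range (f := T) (p := U.1)).trans h)
    omega
  · rw [imageWeight_of_not_le k h, zero_smul]

lemma sum_imageWeight_smul_psiTerm_self [Fintype (End F (Fin n → F))]
    (W : Submodule F (Fin n → F)) (hW : finrank F W = r) :
    ∑ T : End F (Fin n → F), imageWeight k W T • psiTerm k T ⟨W, hW⟩ =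
    (mu k F (finrank F W) *
      (Fintype.card F ^ (finrank F W * finrank F ((Fin n → F) ⧸ W)) : ℕ)) •
        idVec k r ⟨W, hW⟩ := by
  classical
  have hG (T : End F (Fin n → F)) (_ : LinearMap.range T ≤ W) (w : Fin n → F) (hw : w ∈ W)
      (h0 : w ≠ 0) (hTw : T w = 0) : psiTerm k T (⟨W, hW⟩ : GObj F n r) = 0 :=
    psiTerm_of_finrank_ne ((finrank_map_lt hw h0 hTw).trans_eq hW).ne
  have hfix (T : End F (Fin n → F)) (hT : LinearMap.IsProj W T) :
      psiTerm k T (⟨W, hW⟩ : GObj F n r) = idVec k r ⟨W, hW⟩ :=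
    psiTerm_of_fixed hT.map_id
  rw [sum_imageWeight_smul_of_injective W _ hG,
    Finset.sum_congr rfl fun T hT => hfix T (Finset.mem_filter.1 hT).2,
    Finset.sum_const, card_isProj, ← Nat.cast_smul_eq_nsmul k, smul_smul]

theorem psi_etaSub (hq : (Fintype.card F : k) ≠ 0) (W : Submodule F (Fin n → F))
    (hW : finrank F W = r) : psi k r (etaSub k W) = idVec k r ⟨W, hW⟩ := by
  have : Finite (End F (Fin n → F)) := Module.finite_of_finite F
  let _ : Fintype (End F (Fin n → F)) := Fintype.ofFinite _
  -- Perturbing along a functional that vanishes on `U` but not on `W` leaves `T|_U` unchanged.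
  have hne (U : GObj F n r) (hU : U ≠ ⟨W, hW⟩) :
      ∑ T : End F (Fin n → F), imageWeight k W T • psiTerm k T U = 0 := by
    obtain ⟨w, hw, hwU⟩ : ∃ w ∈ W, w ∉ U.1 := by
      refine SetLike.not_le_iff_exists.1 fun hle => hU (Subtype.ext ?_)
      exact (Submodule.eq_of_le_of_finrank_le hle (by rw [hW, U.2])).symm
    obtain ⟨φ, hφw, hφU⟩ := Submodule.exists_le_ker_of_notMem hwU
    refine sum_imageWeight_smul_eq_zero hq W φ
      (fun h0 => hφw (LinearMap.congr_fun h0 ⟨w, hw⟩)) _ fun T v _ => psiTerm_congr fun u hu => ?_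
    have : φ u = 0 := hφU hu
    simp [this]
  rw [etaSub_eq_smul_imageSum, map_smul, psi_imageSum]
  rw [Finset.sum_eq_single ⟨W, hW⟩ (fun U _ hU => hne U hU)
    fun h => absurd (Finset.mem_univ _) h]
  rw [sum_imageWeight_smul_psiTerm_self, smul_smul, etaCoeff_mul hq, one_smul]

end

/-! ### Identities for `q`-binomial coefficients -/

section

lemma qInt_succ_mul (p m : ℕ) : qInt (p + 1) m * p + 1 = (p + 1) ^ m :=
  geom_sum_mul_add p m

lemma qFactorial_pos {q : ℕ} (hq : 0 < q) (n : ℕ) : 0 < qFactorial q n := by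
  refine Finset.prod_pos fun i _ => Finset.sum_pos (fun j _ => pow_pos hq j) ?_
  simp

lemma qBinom_self {q : ℕ} (hq : 0 < q) (n : ℕ) : qBinom q n n = 1 := by
  have h : qFactorial q 0 = 1 := rfl
  simp [qBinom, h, Nat.div_self (qFactorial_pos hq n)]

lemma qBinom_zero {q : ℕ} (hq : 0 < q) (n : ℕ) : qBinom q n 0 = 1 := by
  have h : qFactorial q 0 = 1 := rfl
  simp [qBinom, h, Nat.div_self (qFactorial_pos hq n)]

lemma qBinom_eq_zero (q : ℕ) {n m : ℕ} (h : n < m) : qBinom q n m = 0 :=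
  if_neg (by omega)

/-- The `q`-Pascal identity. -/
lemma qBinom_succ_succ {q : ℕ} (hq : 0 < q) {n m : ℕ} (h : m ≤ n) :
    qBinom q (n + 1) (m + 1) = qBinom q n (m + 1) + q ^ (n - m) * qBinom q n m := by
  obtain rfl | hlt := h.eq_or_lt
  · rw [qBinom_self hq, qBinom_self hq, qBinom_eq_zero q (Nat.lt_succ_self m)]
    simp
  · obtain ⟨e, rfl⟩ := Nat.exists_eq_add_of_lt hlt
    have h1 := qBinom_mul q (n := m + e + 1 + 1) (m := m + 1) (by omega)
    have h2 := qBinom_mul q (n := m + e + 1) (m := m + 1) (by omega)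
    have h3 := qBinom_mul q (n := m + e + 1) (m := m) (by omega)
    rw [show m + e + 1 + 1 - (m + 1) = e + 1 by omega, qFactorial_succ q (m + e + 1),
      show m + e + 1 + 1 = (e + 1) + (m + 1) by omega, qInt_add] at h1
    rw [show m + e + 1 - (m + 1) = e by omega] at h2
    rw [show m + e + 1 - m = e + 1 by omega] at h3
    rw [show m + e + 1 - m = e + 1 by omega, show m + e + 1 + 1 = (e + 1) + (m + 1) by omega]
    have hpos : 0 < qFactorial q (m + 1) * qFactorial q (e + 1) :=
      Nat.mul_pos (qFactorial_pos hq _) (qFactorial_pos hq _)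
    apply Nat.eq_of_mul_eq_mul_right hpos
    rw [h1, add_mul]
    have e2 : qBinom q (m + e + 1) (m + 1) * (qFactorial q (m + 1) * qFactorial q (e + 1)) =
        qFactorial q (m + e + 1) * qInt q (e + 1) := by
      rw [← h2, qFactorial_succ q e]; ring
    have e3 : q ^ (e + 1) * qBinom q (m + e + 1) m *
        (qFactorial q (m + 1) * qFactorial q (e + 1)) =
        qFactorial q (m + e + 1) * (q ^ (e + 1) * qInt q (m + 1)) := by
      rw [← h3, qFactorial_succ q m]; ring
    rw [e2, e3, mul_add]

/-- Each factor is `q^n - q^i = q^i (q - 1) [n-i]_q`. Writing `q = p + 1` avoids the truncated `q -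
1`. -/
lemma prod_pow_sub_pow_mul_qFactorial {p n d : ℕ} (h : d ≤ n) :
    (∏ i : Fin d, ((p + 1) ^ n - (p + 1) ^ (i : ℕ))) * qFactorial (p + 1) (n - d) =
      (∏ i : Fin d, (p + 1) ^ (i : ℕ) * p) * qFactorial (p + 1) n := by
  induction d with
  | zero => simp
  | succ d ih =>
    have e : n - d = n - (d + 1) + 1 := by omega
    have hfac : (p + 1) ^ n - (p + 1) ^ d =
        (p + 1) ^ d * p * qInt (p + 1) (n - (d + 1) + 1) := by
      have h1 := qInt_succ_mul p (n - d)
      have h2 : (p + 1) ^ n = (p + 1) ^ d * (p + 1) ^ (n - d) := by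
        rw [← pow_add]; congr 1; omega
      rw [h2, ← h1, ← e, mul_add, mul_one, Nat.add_sub_cancel]
      ring
    have ih := ih (by omega)
    rw [e, qFactorial_succ] at ih
    rw [Fin.prod_univ_castSucc, Fin.prod_univ_castSucc]
    simp only [Fin.val_castSucc, Fin.val_last]
    rw [hfac, mul_right_comm _ ((p + 1) ^ d * p), ← ih]
    ring

end

/-! ### Counting subspaces -/

section

variable {F V : Type*} [Field F] [AddCommGroup V] [Module F V] [FiniteDimensional F V]

/-- Linearly independent families of length `d` spanning a fixed `d`-dimensional subspace `U`
are linearly independent families in `U`. -/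
def linearIndependentFiberEquiv {d : ℕ} (U : {U : Submodule F V // finrank F U = d}) :
    {s : {s : Fin d → V // LinearIndependent F s} // Submodule.span F (Set.range s.1) = U.1} ≃
      {t : Fin d → U.1 // LinearIndependent F t} where
  toFun s := ⟨fun i => ⟨s.1.1 i, s.2.le (Submodule.subset_span ⟨i, rfl⟩)⟩,
    LinearIndependent.of_comp U.1.subtype s.1.2⟩
  invFun t := ⟨⟨fun i => t.1 i, t.2.map' U.1.subtype U.1.ker_subtype⟩, by
    refine Submodule.eq_of_le_of_finrank_le ?_ ?_
    · rw [Submodule.span_le]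
      rintro _ ⟨i, rfl⟩
      exact (t.1 i).2
    · have h := finrank_span_eq_card (t.2.map' U.1.subtype U.1.ker_subtype)
      rw [Fintype.card_fin] at h
      exact (U.2.trans h.symm).le⟩
  left_inv _ := rfl
  right_inv _ := rfl

variable [Fintype F]

-- Independent `d`-tuples are counted by their span, every fibre being the set of ordered bases of a
-- `d`-dimensional space.
variable (F V) in
lemma card_submodule_finrank_eq (d : ℕ) :
    Nat.card {U : Submodule F V // finrank F U = d} =
      qBinom (Fintype.card F) (finrank F V) d := by
  classical
  have : Finite V := Module.finite_of_finite F
  by_cases hd : d ≤ finrank F V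
  -- A field has at least two elements, so `q - 1 = p + 1` is positive and can be cancelled.
  · obtain ⟨p, hp⟩ : ∃ p, Fintype.card F = p + 2 :=
      ⟨_, (Nat.sub_add_cancel (Fintype.one_lt_card (α := F))).symm⟩
    let f : {s : Fin d → V // LinearIndependent F s} → {U : Submodule F V // finrank F U = d} :=
      fun s => ⟨Submodule.span F (Set.range s.1), by
        rw [finrank_span_eq_card s.2, Fintype.card_fin]⟩
    have hfib (U : {U : Submodule F V // finrank F U = d}) :
        Nat.card {s // f s = U} = ∏ i : Fin d, (Fintype.card F ^ d - Fintype.card F ^ (i : ℕ)) := by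
      have h := card_linearIndependent (K := F) (V := U.1) U.2.ge
      rw [U.2] at h
      rw [← h, ← Nat.card_congr (linearIndependentFiberEquiv U)]
      exact Nat.card_congr (Equiv.subtypeEquivRight fun s => Subtype.ext_iff)
    have hcount := Nat.card_congr (Equiv.sigmaFiberEquiv f)
    let _ : Fintype {U : Submodule F V // finrank F U = d} := Fintype.ofFinite _
    rw [Nat.card_sigma, Finset.sum_congr rfl fun U _ => hfib U, Finset.sum_const,
      Finset.card_univ, ← Nat.card_eq_fintype_card, smul_eq_mul, card_linearIndependent hd,
      hp] at hcount
    have h1 := prod_pow_sub_pow_mul_qFactorial (p := p + 1) hd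
    have h2 := prod_pow_sub_pow_mul_qFactorial (p := p + 1) le_rfl (n := d)
    have h3 := qBinom_mul (p + 2) hd
    have hpos : 0 < (∏ i : Fin d, (p + 1 + 1) ^ (i : ℕ) * (p + 1)) *
        (qFactorial (p + 2) d * qFactorial (p + 2) (finrank F V - d)) :=
      Nat.mul_pos (Finset.prod_pos fun i _ => by positivity)
        (Nat.mul_pos (qFactorial_pos (by omega) _) (qFactorial_pos (by omega) _))
    rw [hp]
    apply Nat.eq_of_mul_eq_mul_right hpos
    have h0 : qFactorial (p + 1 + 1) 0 = 1 := rfl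
    rw [Nat.sub_self, h0, mul_one] at h2
    rw [← hcount, h2, ← h3] at h1
    linarith
  · rw [qBinom_eq_zero _ (not_le.1 hd), Nat.card_eq_zero]
    exact Or.inl ⟨fun U => hd (U.2 ▸ Submodule.finrank_le U.1)⟩

lemma card_submodule_ge_finrank_eq (X : Submodule F V) (e : ℕ) :
    Nat.card {W : Submodule F V // X ≤ W ∧ finrank F W = finrank F X + e} =
      qBinom (Fintype.card F) (finrank F V - finrank F X) e := by
  have hfin : finrank F (V ⧸ X) = finrank F V - finrank F X := by
    have := Submodule.finrank_quotient_add_finrank X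
    omega
  rw [← hfin, ← card_submodule_finrank_eq]
  have hcomap (U : Submodule F (V ⧸ X)) :
      finrank F (U.comap X.mkQ) = finrank F X + finrank F U := by
    have h1 := Submodule.finrank_quotient_add_finrank (U.comap X.mkQ)
    have h2 := Submodule.finrank_quotient_add_finrank U
    have h3 := Submodule.finrank_quotient_add_finrank X
    have h4 := (Submodule.quotientQuotientEquivQuotient X (U.comap X.mkQ)
      (Submodule.le_comap_mkQ X U)).finrank_eq
    rw [Submodule.map_comap_eq_of_surjective X.mkQ_surjective] at h4
    omega
  let Φ : Submodule F (V ⧸ X) ≃ {W : Submodule F V // X ≤ W} :=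
    (Submodule.comapMkQRelIso X).toEquiv
  symm
  refine Nat.card_congr ((Φ.subtypeEquiv
    (q := fun W => finrank F W.1 = finrank F X + e) fun U => ?_).trans
      (Equiv.subtypeSubtypeEquivSubtypeInter (fun W : Submodule F V => X ≤ W)
        fun W => finrank F W = finrank F X + e))
  change _ ↔ finrank F (U.comap X.mkQ) = _
  rw [hcomap]
  omega

end

/-! ### `η_r` as a sum of the `η_W` -/

section

variable {F : Type*} [Fintype F] {n : ℕ} {k : Type*} [Field k]

variable (F k) in
/-- The normalising factor of `η_r` on `F ^ n`. -/
def etaRankCoeff (n r : ℕ) : k := qElt k F ^ (-(((n : ℤ) - 1) * r)) * mu k F r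

/-- Since `μ(d)² = q^(d(d-1))`, the factor `μ(d)⁻¹` can be traded for `μ(d)`, and `d(n-d) + d(d-1) =
d(n-1)`. -/
lemma etaCoeff_eq (hq : (Fintype.card F : k) ≠ 0) {d : ℕ} (hd : d ≤ n) :
    etaCoeff F k d (n - d) = etaRankCoeff F k n d := by
  have hq' : qElt k F ≠ 0 := hq
  have hmu : mu k F d * mu k F d = qElt k F ^ ((d : ℤ) * (d - 1)) := by
    have h : ((d.choose 2 + d.choose 2 : ℕ) : ℤ) = d * (d - 1) := by
      have h1 : d.choose 2 + d.choose 2 = d * (d - 1) := by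
        rw [← mul_two, Nat.choose_two_right, Nat.div_mul_cancel]
        exact (Nat.even_mul_pred_self d).two_dvd
      rw [h1]
      cases d <;> simp
    rw [← h, zpow_natCast, pow_add, mu, mul_mul_mul_comm, ← mul_pow]
    simp
  have hmu0 : mu k F d ≠ 0 := by
    rw [← mul_self_ne_zero, hmu]
    exact zpow_ne_zero _ hq'
  rw [etaCoeff, etaRankCoeff, mul_inv_eq_iff_eq_mul₀ hmu0, mul_assoc, hmu, ← zpow_add₀ hq',
    Nat.cast_sub hd]
  congr 1
  ring

lemma etaRankCoeff_succ (hq : (Fintype.card F : k) ≠ 0) {r : ℕ} (hr : r + 1 ≤ n) :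
    etaRankCoeff F k n (r + 1) * qElt k F ^ (n - 1 - r) = - etaRankCoeff F k n r := by
  have hq' : qElt k F ≠ 0 := hq
  have h : -(((n : ℤ) - 1) * (r + 1 : ℕ)) + r + (n - 1 - r : ℕ) = -((n - 1) * r) := by
    rw [show n - 1 - r = n - (1 + r) by omega, Nat.cast_sub (by omega)]
    push_cast
    ring
  rw [etaRankCoeff, etaRankCoeff, mu_succ, ← h, zpow_add₀ hq', zpow_add₀ hq', zpow_natCast,
    zpow_natCast]
  ring

variable [Field F]

-- Subspaces containing `X` are those of `V/X`, so each dimension contributes a `q`-binomial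
-- coefficient. Its `q`-Pascal expansion has one term cancelling the sum over smaller dimensions, by
-- `etaRankCoeff_succ`.
open Classical in
lemma sum_etaCoeff_ge (hq : (Fintype.card F : k) ≠ 0) (X : Submodule F (Fin n → F)) (e : ℕ)
    (he : finrank F X + e ≤ n) :
    ∑ W ∈ Finset.univ.filter (fun W : Submodule F (Fin n → F) =>
          finrank F W ≤ finrank F X + e ∧ X ≤ W),
        etaCoeff F k (finrank F W) (finrank F ((Fin n → F) ⧸ W)) =
      etaRankCoeff F k n (finrank F X + e) *
        (qBinom (Fintype.card F) (n - 1 - finrank F X) e : k) := by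
  have hpos : 0 < Fintype.card F := Fintype.card_pos
  have hcoeff (W : Submodule F (Fin n → F)) :
      etaCoeff F k (finrank F W) (finrank F ((Fin n → F) ⧸ W)) =
        etaRankCoeff F k n (finrank F W) := by
    have h := Submodule.finrank_quotient_add_finrank W
    rw [Module.finrank_fin_fun] at h
    rw [← etaCoeff_eq hq (by omega), show n - finrank F W = finrank F ((Fin n → F) ⧸ W) by omega]
  simp_rw [hcoeff]
  induction e with
  | zero =>
    -- If `X` is the whole space, `n - 1 - n` truncates to `0`; the value `1` is then the convention
    -- for `[-1 choose 0]_q`.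
    rw [qBinom_zero hpos, Finset.sum_eq_single_of_mem X (by simp)]
    · simp
    · intro W hW hWX
      simp only [Finset.mem_filter_univ] at hW
      exact absurd (Submodule.eq_of_le_of_finrank_le hW.2 hW.1).symm hWX
  | succ e ih =>
    have hcard : (Finset.univ.filter fun W : Submodule F (Fin n → F) =>
        X ≤ W ∧ finrank F W = finrank F X + (e + 1)).card =
          qBinom (Fintype.card F) (n - finrank F X) (e + 1) := by
      have h := card_submodule_ge_finrank_eq X (e + 1)
      rwa [Module.finrank_fin_fun, Nat.card_eq_fintype_card, Fintype.card_subtype] at h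
    have hsum : ∑ W ∈ Finset.univ.filter (fun W : Submodule F (Fin n → F) =>
          X ≤ W ∧ finrank F W = finrank F X + (e + 1)), etaRankCoeff F k n (finrank F W) =
          (qBinom (Fintype.card F) (n - finrank F X) (e + 1) : k) *
            etaRankCoeff F k n (finrank F X + (e + 1)) := by
      rw [Finset.sum_congr rfl fun W hW =>
        congrArg (etaRankCoeff F k n) (Finset.mem_filter.1 hW).2.2, Finset.sum_const, hcard,
        nsmul_eq_mul]
    have hsplit : (Finset.univ.filter fun W : Submodule F (Fin n → F) =>
          finrank F W ≤ finrank F X + (e + 1) ∧ X ≤ W) =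
        (Finset.univ.filter fun W : Submodule F (Fin n → F) => finrank F W ≤ finrank F X + e ∧ X ≤ W) ∪
          Finset.univ.filter fun W : Submodule F (Fin n → F) => X ≤ W ∧ finrank F W = finrank F X + (e + 1) := by
      ext W
      simp only [Finset.mem_union, Finset.mem_filter_univ]
      rw [← add_assoc, Nat.le_succ_iff]
      tauto
    rw [hsplit, Finset.sum_union, ih (by omega), hsum,
      show n - finrank F X = n - 1 - finrank F X + 1 by omega,
      qBinom_succ_succ hpos (by omega), ← add_assoc]
    · have h := etaRankCoeff_succ (F := F) hq (n := n) (r := finrank F X + e) (by omega)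
      rw [← neg_eq_iff_eq_neg] at h
      rw [← h, ← Nat.sub_sub, qElt]
      push_cast
      ring
    · rw [Finset.disjoint_filter]
      rintro W _ ⟨h1, _⟩ ⟨_, h2⟩
      omega

theorem etaRank_eq_sum (hq : (Fintype.card F : k) ≠ 0) {r : ℕ} (hr : r ≤ n) :
    etaRank k F n r =
      ∑ W ∈ Finset.univ.filter (fun W : Submodule F (Fin n → F) => finrank F W ≤ r),
        etaSub k W := by
  classical
  simp_rw [etaSub_eq_sum_matrix, Finset.smul_sum]
  rw [Finset.sum_comm, etaRank, Finset.sum_filter, Finset.smul_sum]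
  refine Finset.sum_congr (by congr!) fun m _ => ?_
  simp_rw [smul_smul]
  rw [← Finset.sum_smul]
  -- The weight of `m` does not depend on `W`; only the condition `im m ≤ W` does.
  have hfac : ∑ W ∈ Finset.univ.filter (fun W : Submodule F (Fin n → F) =>
          finrank F W ≤ r),
        etaCoeff F k (finrank F W) (finrank F ((Fin n → F) ⧸ W)) *
          imageWeight k W (Matrix.toLin' m) =
      (∑ W ∈ Finset.univ.filter (fun W : Submodule F (Fin n → F) =>
          finrank F W ≤ r ∧ LinearMap.range (Matrix.toLin' m) ≤ W),
        etaCoeff F k (finrank F W) (finrank F ((Fin n → F) ⧸ W))) *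
          semiWeight k (Matrix.toLin' m) := by
    rw [← Finset.filter_filter, Finset.sum_filter (fun W => LinearMap.range _ ≤ W), Finset.sum_mul]
    refine Finset.sum_congr rfl fun W _ => ?_
    rw [imageWeight]
    split_ifs <;> simp
  have hrank : m.rank = finrank F (LinearMap.range (Matrix.toLin' m)) := rfl
  rw [hfac, semiWeight_toLin']
  by_cases h : m.rank ≤ r
  · obtain ⟨e, rfl⟩ := Nat.exists_eq_add_of_le h
    rw [hrank] at hr
    rw [hrank, sum_etaCoeff_ge hq _ e hr, etaRankCoeff, Nat.add_sub_cancel_left]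
    by_cases hs : IsSemiIdempotent (Matrix.toLin' m)
    · rw [if_pos ⟨hs, Nat.le_add_right _ _⟩, if_pos hs, smul_smul]
      congr 1
      ring
    · rw [if_neg fun h => hs h.1, if_neg hs, mul_zero, smul_zero, zero_smul]
  · rw [if_neg fun h' => h h'.2, smul_zero, Finset.sum_eq_zero, zero_mul, zero_smul]
    intro W hW
    obtain ⟨h1, h2⟩ := (Finset.mem_filter.1 hW).2
    exact absurd ((Submodule.finrank_mono h2).trans h1) h

end

end

end UnitDecomp

theorem theorem4p2 (F : Type*) [Field F] [Fintype F] (k : Type*) [Field k]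
    (hq : (Fintype.card F : k) ≠ 0) (n : ℕ) :
    -- the `η_W` are pairwise orthogonal idempotents
    ((∀ W : Submodule F (Fin n → F),
        UnitDecomp.etaSub k W * UnitDecomp.etaSub k W = UnitDecomp.etaSub k W) ∧
      (∀ W₁ W₂ : Submodule F (Fin n → F), W₁ ≠ W₂ →
        UnitDecomp.etaSub k W₁ * UnitDecomp.etaSub k W₂ = 0)) ∧
    -- `η_r` is the sum of the `η_W` with `dim W ≤ r`
    (∀ r : ℕ, r ≤ n →
      UnitDecomp.etaRank k F n r =
        ∑ W ∈ Finset.univ.filter (fun W : Submodule F (Fin n → F) => Module.finrank F W ≤ r),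
          UnitDecomp.etaSub k W) ∧
    -- values of `ψ_r`
    (∀ (r : ℕ) (W : Submodule F (Fin n → F)) (hW : Module.finrank F W = r),
      UnitDecomp.psi k r (UnitDecomp.etaSub k W) = UnitDecomp.idVec k r ⟨W, hW⟩) ∧
    (∀ (r : ℕ) (W : Submodule F (Fin n → F)), Module.finrank F W < r →
      UnitDecomp.psi k r (UnitDecomp.etaSub k W) = 0) :=
  ⟨⟨UnitDecomp.etaSub_mul_self hq, fun _ _ h => UnitDecomp.etaSub_mul_of_ne hq h⟩,
    fun _ hr => UnitDecomp.etaRank_eq_sum hq hr,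
    fun _ W hW => UnitDecomp.psi_etaSub hq W hW,
    fun _ W hW => UnitDecomp.psi_etaSub_of_finrank_lt W hW⟩
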